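/- A radio network is a connected undirected graph whose nodes carry distinct labels from $\{0,\dots,m\}$; the node labelled $0$ is the source. A deterministic broadcast protocol works in synchronous rounds $0,1,2,\dots$. In each round every node transmits a message (of arbitrary content), acts as a receiver, or is inactive. A node receives a message in a round if and only if it acts as a receiver and exactly one of its neighbours transmits in that round; it then also learns the label of the sender, and otherwise it receives the empty symbol $\phi$. All nodes run the same protocol: the action of a node in a round is a function of its own label, the set of labels of its neighbours, and the sequence of what it received in the previous rounds. In round $0$ the source transmits the broadcast message, and a node other than the source may transmit only after it has received some message (messages may carry the source message, so a node counts as having received the source message once it has received a message). Broadcast is completed in $r$ rounds if every node other than the source receives the source message in one of the rounds $0,\dots,r-1$. **Corollary.** There is an absolute constant $c>0$ such that for all integers $n, D, m$ with $3\le D<n\le m+1$ and every deterministic broadcast protocol $\pi$ for labels in $\{0,\dots,m\}$ (which may depend on $n$, $D$ and $m$) there is a radio network $N$ with exactly $n$ nodes and diameter $D$ such that every $r$ for which $\pi$ completes broadcast on $N$ in $r$ rounds satisfies $r\ge c\sqrt{nD}$. That is, every deterministic broadcast protocol needs $\Omega(\sqrt{nD})$ rounds on some radio network with $n$ nodes and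 diameter $D$. -/

import Mathlib

/-- A radio network with node set `V`: a connected undirected graph whose nodes carry distinct
labels from `{0, …, m}`, with a distinguished source node, the one labelled `0`. -/
structure RadioNetwork (V : Type) (m : ℕ) where
  graph : SimpleGraph V
  connected : graph.Connected
  label : V → Fin (m + 1)
  label_injective : Function.Injective label
  source : V
  label_source : label source = 0

/-- The labels of the neighbours of `v`. -/
def RadioNetwork.neighborLabels {V : Type} {m : ℕ} (N : RadioNetwork V m) (v : V) :
    Set (Fin (m + 1)) :=
  N.label '' N.graph.neighborSet v

/-- What a node may do in one round. -/
inductive RadioAction (Msg : Type*) where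
  | transmit (msg : Msg)
  | receive
  | inactive

/-- What a node gets in one round: `none` is the empty reception `φ`; a message arrives together
with the label of its sender. -/
abbrev Reception (m : ℕ) (Msg : Type*) := Option (Fin (m + 1) × Msg)

/-- A deterministic broadcast protocol for labels `{0, …, m}` and messages `Msg`. Every node runs
the same function `act`: its action in round `t` is determined by its own label, the set of labels
of its neighbours, and the list (of length `t`) of what it received in rounds `0, …, t - 1`. -/
structure BroadcastProtocol (m : ℕ) (Msg : Type*) where
  act : Fin (m + 1) → Set (Fin (m + 1)) → List (Reception m Msg) → RadioAction Msg
  /-- In round `0` the source transmits. -/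
  source_transmits : ∀ S, ∃ msg, act 0 S [] = RadioAction.transmit msg
  /-- A node other than the source that has not received any message does not transmit. -/
  not_spontaneous : ∀ l, l ≠ 0 → ∀ S h, (∀ x ∈ h, x = none) →
    ∀ msg, act l S h ≠ RadioAction.transmit msg

open Classical in
/-- The outcome of one round at the node `v`, when the nodes act as given by `a`: the node gets a
message if and only if it acts as a receiver and exactly one of its neighbours transmits. -/
noncomputable def RadioNetwork.receive {V : Type} {m : ℕ} {Msg : Type*} (N : RadioNetwork V m)
    (a : V → RadioAction Msg) (v : V) : Reception m Msg :=
  if h : a v = RadioAction.receive ∧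
      ∃! p : V × Msg, N.graph.Adj v p.1 ∧ a p.1 = RadioAction.transmit p.2 then
    some (N.label h.2.choose.1, h.2.choose.2)
  else none

/-- `v` receives `msg` from the sender labelled `l` exactly when it acts as a receiver and a unique
neighbour of `v`, which has label `l`, transmits, its message being `msg`. -/
theorem RadioNetwork.receive_eq_some_iff {V : Type} {m : ℕ} {Msg : Type*} (N : RadioNetwork V m)
    (a : V → RadioAction Msg) (v : V) (l : Fin (m + 1)) (msg : Msg) :
    N.receive a v = some (l, msg) ↔ a v = RadioAction.receive ∧
      ∃ w, N.graph.Adj v w ∧ a w = RadioAction.transmit msg ∧ N.label w = l ∧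
        ∀ w', N.graph.Adj v w' → (∃ msg', a w' = RadioAction.transmit msg') → w' = w := by
  unfold RadioNetwork.receive
  constructor
  · intro h
    split_ifs at h with hc
    have hs := hc.2.choose_spec
    simp only [Option.some.injEq, Prod.mk.injEq] at h
    refine ⟨hc.1, hc.2.choose.1, hs.1.1, h.2 ▸ hs.1.2, h.1, ?_⟩
    rintro w' hw' ⟨msg', hm⟩
    exact congrArg Prod.fst (hs.2 (w', msg') ⟨hw', hm⟩)
  · rintro ⟨hv, w, hw, hm, hl, hu⟩
    have hex : ∃! p : V × Msg, N.graph.Adj v p.1 ∧ a p.1 = RadioAction.transmit p.2 := by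
      refine ⟨(w, msg), ⟨hw, hm⟩, ?_⟩
      rintro ⟨w', msg'⟩ ⟨h1, h2⟩
      obtain rfl := hu w' h1 ⟨msg', h2⟩
      rw [hm] at h2
      cases h2
      rfl
    rw [dif_pos ⟨hv, hex⟩]
    have he : hex.choose = (w, msg) := hex.unique hex.choose_spec.1 ⟨hw, hm⟩
    simp only [he, hl]

/-- The list of what `v` has received in rounds `0, …, t - 1` of the execution of `π` on `N`. -/
noncomputable def BroadcastProtocol.history {V : Type} {m : ℕ} {Msg : Type*}
    (π : BroadcastProtocol m Msg) (N : RadioNetwork V m) : ℕ → V → List (Reception m Msg)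
  | 0, _ => []
  | t + 1, v => π.history N t v ++
      [N.receive (fun w => π.act (N.label w) (N.neighborLabels w) (π.history N t w)) v]

/-- The execution of `π` on `N` completes broadcast in `r` rounds: every node other than the source
has received the source message in one of the rounds `0, …, r - 1`. Messages are of unrestricted
content and only the source and nodes that have already received a message transmit, so every
transmission can have the source message attached: receiving any message counts as receiving the
source message. -/
def BroadcastProtocol.CompletesIn {V : Type} {m : ℕ} {Msg : Type*}
    (π : BroadcastProtocol m Msg) (N : RadioNetwork V m) (r : ℕ) : Prop :=
  ∀ v, v ≠ N.source → ∃ x ∈ π.history N r v, x ≠ none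

/-! An adversary builds the network while simulating the protocol. The network is a chain of `g`
gadgets starting at a star that contains the source. In a gadget, the root and all `c i k` form a
clique, and each group `i` has one more vertex `t i`, joined to a nonempty set `S i` of the clique
vertices `c i k` of that group. The sets can be chosen so that some `t i` is never reached in the
next `τ` rounds, whenever the clique gets informed (`exists_gadget`). That `t i` is the root of the
next gadget, so each gadget adds 2 to the distance from the source and `τ` rounds to the delay
(`Chain.succ`). A gadget has `2τ + 1` groups of `τ + 2` vertices, so for `g ≈ D/2` and `g τ² ≈ n` up
to constants the delay `g τ` is of order `√(nD)`.

Inside a gadget the adversary keeps a family of possible sets for every group and maintains that the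
execution reveals nothing about the choice (`Position`). A round threatens `t i` only if exactly one
vertex of `S i` transmits. Sets for which this happens are discarded (`Position.thin`), which uses
up one unit of richness. A round leaks information to the clique only if it has a single transmitter
there. If two undecided groups could transmit, fixing both forces a collision; otherwise fixing at
most one silences the undecided groups (`Position.fix_noisy`). Hence a round costs at most two
groups.

Vertices that have received nothing are silent, so edges among them can be chosen later without
changing the past (`Stable`). This is what allows gadgets to be attached one at a time. -/

namespace RadioBroadcast

/-! ### Executions, and edges that can still be changed -/

section Execution

variable {V : Type} {m : ℕ} {Msg : Type*}

open Classical in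
/-- The outcome of one round at `v` on an arbitrary labelled graph, connected or not. -/
noncomputable def hear (lab : V → Fin (m + 1)) (G : SimpleGraph V) (a : V → RadioAction Msg)
    (v : V) : Reception m Msg :=
  if h : a v = RadioAction.receive ∧
      ∃! p : V × Msg, G.Adj v p.1 ∧ a p.1 = RadioAction.transmit p.2 then
    some (lab h.2.choose.1, h.2.choose.2)
  else none

/-- The histories of the execution of `π` on an arbitrary labelled graph. -/
noncomputable def hist (π : BroadcastProtocol m Msg) (lab : V → Fin (m + 1)) (G : SimpleGraph V) :
    ℕ → V → List (Reception m Msg)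
  | 0, _ => []
  | t + 1, v => hist π lab G t v ++
      [hear lab G (fun w => π.act (lab w) (lab '' G.neighborSet w) (hist π lab G t w)) v]

/-- The action of `v` in round `t`. -/
noncomputable def action (π : BroadcastProtocol m Msg) (lab : V → Fin (m + 1)) (G : SimpleGraph V)
    (t : ℕ) (v : V) : RadioAction Msg :=
  π.act (lab v) (lab '' G.neighborSet v) (hist π lab G t v)

def Transmits (π : BroadcastProtocol m Msg) (lab : V → Fin (m + 1)) (G : SimpleGraph V)
    (t : ℕ) (v : V) : Prop :=
  ∃ msg, action π lab G t v = RadioAction.transmit msg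

/-- Exactly one neighbour of `v` transmits in round `t`. -/
def Reached (π : BroadcastProtocol m Msg) (lab : V → Fin (m + 1)) (G : SimpleGraph V)
    (t : ℕ) (v : V) : Prop :=
  ∃! w, G.Adj v w ∧ Transmits π lab G t w

variable {π : BroadcastProtocol m Msg} {lab : V → Fin (m + 1)} {G G' : SimpleGraph V} {t : ℕ}
  {v : V}

theorem history_eq_hist (π : BroadcastProtocol m Msg) (N : RadioNetwork V m) (t : ℕ) :
    π.history N t = hist π N.label N.graph t := by
  induction t with
  | zero => rfl
  | succ t ih =>
    funext v
    simp only [BroadcastProtocol.history, hist, ih]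
    rfl

theorem hist_succ : hist π lab G (t + 1) v =
    hist π lab G t v ++ [hear lab G (action π lab G t) v] := rfl

theorem hist_subset {s : ℕ} (h : s ≤ t) : hist π lab G s v ⊆ hist π lab G t v := by
  induction t, h using Nat.le_induction with
  | base => exact List.Subset.refl _
  | succ t _ ih => exact fun x hx => List.mem_append_left _ (ih hx)

theorem hear_of_not_reached (h : ¬ Reached π lab G t v) :
    hear lab G (action π lab G t) v = none := by
  unfold hear
  rw [dif_neg]
  rintro ⟨_, ⟨w, msg⟩, hw, hu⟩
  refine h ⟨w, ⟨hw.1, msg, hw.2⟩, ?_⟩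
  rintro w' ⟨h1, msg', h2⟩
  exact congrArg Prod.fst (hu (w', msg') ⟨h1, h2⟩)

theorem hear_of_transmits (h : Transmits π lab G t v) :
    hear lab G (action π lab G t) v = none := by
  unfold hear
  rw [dif_neg]
  rintro ⟨h1, -⟩
  obtain ⟨msg, h2⟩ := h
  rw [h1] at h2
  cases h2

theorem hist_succ_of_not_reached (h0 : hist π lab G t v = List.replicate t none)
    (h : ¬ Reached π lab G t v) : hist π lab G (t + 1) v = List.replicate (t + 1) none := by
  rw [hist_succ, h0, hear_of_not_reached h, List.replicate_succ']

theorem not_transmits_of_uninformed (hl : lab v ≠ 0)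
    (h0 : hist π lab G t v = List.replicate t none) : ¬ Transmits π lab G t v := by
  rintro ⟨msg, h⟩
  refine π.not_spontaneous _ hl _ _ ?_ msg h
  rw [h0]
  exact fun x hx => (List.mem_replicate.1 hx).2

theorem action_congr (hn : ∀ w, G.Adj v w ↔ G'.Adj v w)
    (hh : hist π lab G t v = hist π lab G' t v) : action π lab G t v = action π lab G' t v := by
  have : G.neighborSet v = G'.neighborSet v := Set.ext hn
  simp only [action, hh, this]

theorem transmits_congr (h : action π lab G t v = action π lab G' t v) :
    Transmits π lab G t v ↔ Transmits π lab G' t v := by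
  simp only [Transmits, h]

theorem hear_congr (ha : action π lab G t v = action π lab G' t v)
    (hn : ∀ w, G.Adj v w ↔ G'.Adj v w)
    (hw : ∀ w, G.Adj v w → action π lab G t w = action π lab G' t w ∨
      ¬ Transmits π lab G t w ∧ ¬ Transmits π lab G' t w) :
    hear lab G (action π lab G t) v = hear lab G' (action π lab G' t) v := by
  have : (fun p : V × Msg => G.Adj v p.1 ∧ action π lab G t p.1 = RadioAction.transmit p.2) =
      fun p : V × Msg => G'.Adj v p.1 ∧ action π lab G' t p.1 = RadioAction.transmit p.2 := by
    funext ⟨w, msg⟩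
    simp only [← hn, eq_iff_iff, and_congr_right_iff]
    intro hvw
    rcases hw w hvw with h | h
    · rw [h]
    · exact ⟨fun h' => (h.1 ⟨_, h'⟩).elim, fun h' => (h.2 ⟨_, h'⟩).elim⟩
  -- The received pair is chosen from the uniqueness proof, so the predicates are generalized and
  -- then identified by substitution.
  have key : ∀ (P P' : V × Msg → Prop) (x x' : RadioAction Msg), P = P' → x = x' →
      (open scoped Classical in if h : x = RadioAction.receive ∧ ∃! p, P p then
        some (lab h.2.choose.1, h.2.choose.2) else none) =
      (open scoped Classical in if h : x' = RadioAction.receive ∧ ∃! p, P' p then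
        some (lab h.2.choose.1, h.2.choose.2) else none) := by
    rintro P _ x _ rfl rfl
    rfl
  exact key _ _ _ _ this ha

/-- A vertex at level above `t` has received nothing before round `t`. -/
theorem hist_of_lt_level {f : V → ℕ} (hf : ∀ u w, G.Adj u w → f u ≤ f w + 1)
    (h0 : ∀ u, lab u = 0 → f u = 0) (hv : t < f v) :
    hist π lab G t v = List.replicate t none := by
  induction t generalizing v with
  | zero => rfl
  | succ t ih =>
    refine hist_succ_of_not_reached (ih (by omega)) ?_
    rintro ⟨w, ⟨hw, hT⟩, -⟩
    have := hf v w hw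
    exact not_transmits_of_uninformed (fun h => by have := h0 w h; omega) (ih (by omega)) hT

/-- `G` and `G'` have the same edges apart from edges inside `U`. -/
def AgreeOff (U : Set V) (G G' : SimpleGraph V) : Prop :=
  ∀ u w, ¬ (u ∈ U ∧ w ∈ U) → (G.Adj u w ↔ G'.Adj u w)

/-- The vertices in `U` have received nothing before round `T`, and changing edges inside `U`
does not affect the execution before round `T`. -/
def Stable (π : BroadcastProtocol m Msg) (lab : V → Fin (m + 1)) (G : SimpleGraph V) (U : Set V)
    (T : ℕ) : Prop :=
  (∀ v ∈ U, hist π lab G T v = List.replicate T none) ∧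
    ∀ G', AgreeOff U G G' → ∀ v, hist π lab G' T v = hist π lab G T v

theorem Stable.mono {U U' : Set V} (h : Stable π lab G U t) (hU : U' ⊆ U)
    (hG : AgreeOff U G G') : Stable π lab G' U' t := by
  refine ⟨fun v hv => (h.2 G' hG v).trans (h.1 v (hU hv)), fun G'' hG' v => ?_⟩
  rw [h.2 G' hG v]
  refine h.2 G'' (fun u w huw => (hG u w huw).trans (hG' u w ?_)) v
  exact fun h' => huw ⟨hU h'.1, hU h'.2⟩

theorem stable_zero (G : SimpleGraph V) (U : Set V) : Stable π lab G U 0 :=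
  ⟨fun _ _ => rfl, fun _ _ _ => rfl⟩

/-- Changing edges inside `U` affects the neighbourhoods of vertices of `U` only, and these are
silent. Being unreached is required, rather than merely hearing nothing: a vertex of `U` that is
reached while not receiving could act as a receiver once its neighbourhood is changed. -/
theorem Stable.succ {U : Set V} (h : Stable π lab G U t) (hl : ∀ v ∈ U, lab v ≠ 0)
    (hr : ∀ v ∈ U, ¬ Reached π lab G t v) : Stable π lab G U (t + 1) := by
  refine ⟨fun v hv => hist_succ_of_not_reached (h.1 v hv) (hr v hv), fun G' hG v => ?_⟩
  have hh := h.2 G' hG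
  have hact : ∀ w ∉ U, action π lab G' t w = action π lab G t w := fun w hw =>
    action_congr (fun x => (hG w x fun h' => hw h'.1).symm) (hh w)
  have hsil : ∀ w ∈ U, ¬ Transmits π lab G' t w ∧ ¬ Transmits π lab G t w := fun w hw =>
    ⟨not_transmits_of_uninformed (hl w hw) ((hh w).trans (h.1 w hw)),
      not_transmits_of_uninformed (hl w hw) (h.1 w hw)⟩
  rw [hist_succ, hist_succ, hh v]
  congr 2
  by_cases hv : v ∈ U
  · rw [hear_of_not_reached (hr v hv), hear_of_not_reached]
    refine fun hR => hr v hv ((existsUnique_congr fun w => ?_).1 hR)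
    by_cases hw : w ∈ U
    · simp [hsil w hw]
    · rw [hG v w fun h' => hw h'.2, transmits_congr (hact w hw)]
  · refine hear_congr (hact v hv) (fun x => (hG v x fun h' => hv h'.1).symm) fun w _ => ?_
    by_cases hw : w ∈ U
    · exact Or.inr (hsil w hw)
    · exact Or.inl (hact w hw)

theorem Stable.add {U : Set V} (h : Stable π lab G U t) (hl : ∀ v ∈ U, lab v ≠ 0) (τ : ℕ)
    (hr : ∀ s, t ≤ s → s < t + τ → ∀ v ∈ U, ¬ Reached π lab G s v) :
    Stable π lab G U (t + τ) := by
  induction τ with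
  | zero => exact h
  | succ τ ih =>
    exact (ih fun s h1 h2 => hr s h1 (by omega)).succ hl (hr _ (by omega) (by omega))

end Execution

/-! ### Sets that avoid unique intersections -/

section Selection

variable {κ : Type*}

/-- Against any `d` sets, some member of `F` meets none of them in exactly one point. -/
def Rich (d : ℕ) (F : Set (Set κ)) : Prop :=
  ∀ Ms : Finset (Set κ), Ms.card ≤ d → ∃ S ∈ F, ∀ M ∈ Ms, ¬ ∃! k, k ∈ M ∧ k ∈ S

theorem Rich.nonempty {d : ℕ} {F : Set (Set κ)} (h : Rich d F) : F.Nonempty := by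
  obtain ⟨S, hS, -⟩ := h ∅ (by simp)
  exact ⟨S, hS⟩

/-- `M` is simply counted among the sets to be avoided; this is the price of one round. -/
theorem Rich.inter {d : ℕ} {F : Set (Set κ)} (h : Rich (d + 1) F) (M : Set κ) :
    Rich d {S | S ∈ F ∧ ¬ ∃! k, k ∈ M ∧ k ∈ S} := by
  classical
  intro Ms hMs
  obtain ⟨S, hS, hM⟩ := h (insert M Ms) ((Finset.card_insert_le _ _).trans (by omega))
  exact ⟨S, ⟨hS, hM M (Finset.mem_insert_self _ _)⟩,
    fun M' hM' => hM M' (Finset.mem_insert_of_mem hM')⟩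

/-- If `X` meets some `M` in a single point `k`, delete both: subsets of `X \ {k}` miss `M`
altogether, and one point was spent on one set. -/
theorem exists_subset_not_existsUnique (X : Finset κ) (Ms : Finset (Set κ))
    (h : Ms.card < X.card) :
    ∃ S : Set κ, S ⊆ X ∧ S.Nonempty ∧ ∀ M ∈ Ms, ¬ ∃! k, k ∈ M ∧ k ∈ S := by
  classical
  induction hc : Ms.card generalizing X Ms with
  | zero =>
    obtain rfl := Finset.card_eq_zero.1 hc
    exact ⟨X, subset_rfl, Finset.coe_nonempty.2 (Finset.card_pos.1 (by omega)), by simp⟩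
  | succ d ih =>
    by_cases hX : ∀ M ∈ Ms, ¬ ∃! k, k ∈ M ∧ k ∈ (X : Set κ)
    · exact ⟨X, subset_rfl, Finset.coe_nonempty.2 (Finset.card_pos.1 (by omega)), hX⟩
    push Not at hX
    obtain ⟨M, hM, k, ⟨hkM, hkX⟩, huniq⟩ := hX
    have hkX' : k ∈ X := hkX
    obtain ⟨S, hSX, hS, hSM⟩ := ih (X.erase k) (Ms.erase M)
      (by rw [Finset.card_erase_of_mem hM, Finset.card_erase_of_mem hkX']; omega)
      (by rw [Finset.card_erase_of_mem hM]; omega)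
    refine ⟨S, fun x hx => Finset.mem_of_mem_erase (hSX hx), hS, fun M' hM' => ?_⟩
    by_cases hMM : M' = M
    · rintro ⟨x, ⟨hxM, hxS⟩, -⟩
      have hx := Finset.mem_erase.1 (hSX hxS)
      exact hx.1 (huniq x ⟨hMM ▸ hxM, hx.2⟩)
    · exact hSM M' (Finset.mem_erase.2 ⟨hMM, hM'⟩)

theorem rich_nonempty [Fintype κ] {d : ℕ} (h : d < Fintype.card κ) :
    Rich d {S : Set κ | S.Nonempty} := fun Ms hMs => by
  obtain ⟨S, -, h1, h2⟩ := exists_subset_not_existsUnique Finset.univ Ms (by simpa using by omega)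
  exact ⟨S, h1, h2⟩

end Selection

/-! ### The adversary inside one gadget -/

section Gadget

variable {V ι κ : Type} {m : ℕ} {Msg : Type*} {π : BroadcastProtocol m Msg}
  {lab : V → Fin (m + 1)}

/-- The clique of a gadget: the root `r` and the vertices `c i k`. -/
def hub (r : V) (c : ι → κ → V) : Set V := {v | v = r ∨ ∃ i k, v = c i k}

def spoke (c : ι → κ → V) (t : ι → V) (S : ι → Set κ) (u w : V) : Prop :=
  ∃ i k, k ∈ S i ∧ u = t i ∧ w = c i k

/-- `G` with a gadget attached at the vertex `r`: the root `r` and all `c i k` become a clique, and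
`t i` becomes adjacent to the vertices `c i k` with `k ∈ S i`. -/
def gadget (G : SimpleGraph V) (r : V) (c : ι → κ → V) (t : ι → V) (S : ι → Set κ) :
    SimpleGraph V where
  Adj u w := G.Adj u w ∨
    u ≠ w ∧ (u ∈ hub r c ∧ w ∈ hub r c ∨ spoke c t S u w ∨ spoke c t S w u)
  symm := ⟨fun u w h => by
    rcases h with h | ⟨h1, h2⟩
    · exact Or.inl h.symm
    · exact Or.inr ⟨h1.symm, by tauto⟩⟩
  loopless := ⟨fun u h => by
    rcases h with h | h
    · exact G.loopless.irrefl u h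
    · exact h.1 rfl⟩

/-- The vertices `c i k` and `t i` are distinct from each other and from `r`, and isolated. -/
structure GadgetSite (G : SimpleGraph V) (r : V) (c : ι → κ → V) (t : ι → V) : Prop where
  c_inj : ∀ i k i' k', c i k = c i' k' → i = i' ∧ k = k'
  t_inj : ∀ i i', t i = t i' → i = i'
  c_ne_t : ∀ i k j, c i k ≠ t j
  c_ne_r : ∀ i k, c i k ≠ r
  t_ne_r : ∀ i, t i ≠ r
  c_isolated : ∀ i k v, ¬ G.Adj (c i k) v
  t_isolated : ∀ i v, ¬ G.Adj (t i) v

variable {G : SimpleGraph V} {r : V} {c : ι → κ → V} {t : ι → V}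

theorem GadgetSite.t_notMem_hub (h : GadgetSite G r c t) (i : ι) : t i ∉ hub r c := by
  rintro (h' | ⟨j, k, h'⟩)
  · exact h.t_ne_r i h'
  · exact h.c_ne_t j k i h'.symm

theorem GadgetSite.adj_t (h : GadgetSite G r c t) (S : ι → Set κ) (i : ι) (w : V) :
    (gadget G r c t S).Adj (t i) w ↔ ∃ k ∈ S i, w = c i k := by
  constructor
  · rintro (h' | ⟨-, h' | h' | h'⟩)
    · exact (h.t_isolated i w h').elim
    · exact (h.t_notMem_hub i h'.1).elim
    · obtain ⟨j, k, hk, hj, hw⟩ := h'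
      obtain rfl := h.t_inj _ _ hj
      exact ⟨k, hk, hw⟩
    · obtain ⟨j, k, hk, hj, hw⟩ := h'
      exact (h.c_ne_t _ _ _ hw.symm).elim
  · rintro ⟨k, hk, rfl⟩
    exact Or.inr ⟨(h.c_ne_t i k i).symm, Or.inr (Or.inl ⟨i, k, hk, rfl, rfl⟩)⟩

theorem adj_hub {S : ι → Set κ} {u w : V} (hu : u ∈ hub r c) (hw : w ∈ hub r c) (huw : u ≠ w) :
    (gadget G r c t S).Adj u w :=
  Or.inr ⟨huw, Or.inl ⟨hu, hw⟩⟩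

theorem c_mem_hub (i : ι) (k : κ) : c i k ∈ hub r c := Or.inr ⟨i, k, rfl⟩

/-- `v` has the same neighbours for `S` as for `S'`, provided that these agree on `B`. -/
def Aligned (c : ι → κ → V) (t : ι → V) (B : Finset ι) (S S' : ι → Set κ) (v : V) : Prop :=
  (∀ i ∉ B, v ≠ t i) ∧ ∀ i k, v = c i k → (k ∈ S i ↔ k ∈ S' i)

theorem Aligned.adj_iff {B : Finset ι} {S S' : ι → Set κ} {v : V} (h : Aligned c t B S S' v)
    (hB : ∀ i ∈ B, S i = S' i) (w : V) :
    (gadget G r c t S).Adj v w ↔ (gadget G r c t S').Adj v w := by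
  have h1 : spoke c t S v w ↔ spoke c t S' v w := by
    have : ∀ i, v = t i → S i = S' i := fun i hi =>
      hB i (by by_contra hb; exact h.1 i hb hi)
    constructor
    · rintro ⟨i, k, hk, hv, hw⟩
      exact ⟨i, k, this i hv ▸ hk, hv, hw⟩
    · rintro ⟨i, k, hk, hv, hw⟩
      exact ⟨i, k, (this i hv).symm ▸ hk, hv, hw⟩
  have h2 : spoke c t S w v ↔ spoke c t S' w v := by
    constructor
    · rintro ⟨i, k, hk, hw, hv⟩
      exact ⟨i, k, (h.2 i k hv).1 hk, hw, hv⟩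
    · rintro ⟨i, k, hk, hw, hv⟩
      exact ⟨i, k, (h.2 i k hv).2 hk, hw, hv⟩
  change _ ∨ _ ∧ _ ↔ _ ∨ _ ∧ _
  rw [h1, h2]

variable (π lab G r c t) in
/-- The adversary's position before round `s`: `F i` is the family of sets still possible for
the group `i`, and the groups in `B` are fixed. The execution before round `s` reveals nothing else,
and no `t i` with `i ∉ B` has been reached since round `T`. -/
structure Position (T s d : ℕ) (F : ι → Set (Set κ)) (B : Finset ι) : Prop where
  fixed : ∀ i ∈ B, (F i).Subsingleton
  nonempty : ∀ i, (F i).Nonempty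
  nonempty_mem : ∀ i, ∀ S ∈ F i, S.Nonempty
  rich : ∀ i ∉ B, Rich d (F i)
  uninformed : ∀ S : ι → Set κ, (∀ i, S i ∈ F i) → ∀ i ∉ B,
    hist π lab (gadget G r c t S) s (t i) = List.replicate s none
  hist_eq : ∀ S S' : ι → Set κ, (∀ i, S i ∈ F i) → (∀ i, S' i ∈ F i) → ∀ v,
    Aligned c t B S S' v →
      hist π lab (gadget G r c t S) s v = hist π lab (gadget G r c t S') s v
  not_reached : ∀ S : ι → Set κ, (∀ i, S i ∈ F i) → ∀ i ∉ B, ∀ s', T ≤ s' → s' < s →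
    ¬ Reached π lab (gadget G r c t S) s' (t i)

variable {T s d : ℕ} {F F' : ι → Set (Set κ)} {B B' : Finset ι}

theorem Position.action_eq (h : Position π lab G r c t T s d F B) {S S' : ι → Set κ}
    (hS : ∀ i, S i ∈ F i) (hS' : ∀ i, S' i ∈ F i) {v : V} (hv : Aligned c t B S S' v) :
    action π lab (gadget G r c t S) s v = action π lab (gadget G r c t S') s v :=
  action_congr (hv.adj_iff fun i hi => h.fixed i hi (hS i) (hS' i)) (h.hist_eq S S' hS hS' v hv)

/-- Whether `c i k` transmits depends only on the set chosen for the group `i`. -/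
theorem Position.transmits_c (h : Position π lab G r c t T s d F B) (hs : GadgetSite G r c t)
    {S S' : ι → Set κ} (hS : ∀ i, S i ∈ F i) (hS' : ∀ i, S' i ∈ F i) {i : ι} {k : κ}
    (hk : k ∈ S i ↔ k ∈ S' i) :
    Transmits π lab (gadget G r c t S) s (c i k) ↔
      Transmits π lab (gadget G r c t S') s (c i k) := by
  refine transmits_congr (h.action_eq hS hS' ⟨fun j _ => hs.c_ne_t i k j, fun i' k' he => ?_⟩)
  obtain ⟨rfl, rfl⟩ := hs.c_inj _ _ _ _ he
  exact hk

/-- The groups outside `B` can be thinned out so that the next round does not reach them. -/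
theorem Position.thin (h : Position π lab G r c t T s (d + 1) F B) (hs : GadgetSite G r c t) :
    ∃ F', Position π lab G r c t T s d F' B ∧ ∀ S : ι → Set κ, (∀ i, S i ∈ F' i) → ∀ i ∉ B,
      ¬ Reached π lab (gadget G r c t S) s (t i) := by
  -- The transmitters that `t i` could hear. By `transmits_c`, whether `c i k` with `k ∈ S i`
  -- transmits does not depend on the rest of the choice, so the transmitting neighbours of `t i`
  -- are exactly `M i ∩ S i`.
  let M : ι → Set κ := fun i => {k | ∃ S : ι → Set κ, (∀ j, S j ∈ F j) ∧ k ∈ S i ∧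
    Transmits π lab (gadget G r c t S) s (c i k)}
  let F' : ι → Set (Set κ) := fun i =>
    {A | A ∈ F i ∧ (i ∉ B → A ∈ {S | S ∈ F i ∧ ¬ ∃! k, k ∈ M i ∧ k ∈ S})}
  have hsub : ∀ S : ι → Set κ, (∀ i, S i ∈ F' i) → ∀ i, S i ∈ F i := fun S hS i => (hS i).1
  have hrich : ∀ i ∉ B, Rich d (F' i) := fun i hi Ms hMs => by
    obtain ⟨A, hA, hAM⟩ := (h.rich i hi).inter (M i) Ms hMs
    exact ⟨A, ⟨hA.1, fun _ => hA⟩, hAM⟩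
  refine ⟨F', ⟨fun i hi => (h.fixed i hi).anti fun A hA => hA.1, fun i => ?_,
    fun i A hA => h.nonempty_mem i A hA.1, hrich, fun S hS => h.uninformed S (hsub S hS),
    fun S S' hS hS' => h.hist_eq S S' (hsub S hS) (hsub S' hS'),
    fun S hS => h.not_reached S (hsub S hS)⟩, fun S hS i hi hR => ?_⟩
  · by_cases hi : i ∈ B
    · obtain ⟨A, hA⟩ := h.nonempty i
      exact ⟨A, hA, fun h' => (h' hi).elim⟩
    · exact (hrich i hi).nonempty
  · obtain ⟨w, ⟨hw, hwT⟩, hu⟩ := hR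
    obtain ⟨k, hk, rfl⟩ := (hs.adj_t S i w).1 hw
    refine ((hS i).2 hi).2 ⟨k, ⟨⟨S, hsub S hS, hk, hwT⟩, hk⟩, ?_⟩
    rintro k' ⟨⟨S', hS', hk', hT'⟩, hkS⟩
    have := hu (c i k') ⟨(hs.adj_t S i _).2 ⟨k', hkS, rfl⟩,
      (h.transmits_c hs hS' (hsub S hS) (by simp [hk', hkS])).1 hT'⟩
    exact (hs.c_inj _ _ _ _ this).2

/-- Fixing the sets of further groups. -/
theorem Position.fix (h : Position π lab G r c t T s d F B) (hF : ∀ i, F' i ⊆ F i)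
    (hB : B ⊆ B') (hfix : ∀ i ∈ B', (F' i).Subsingleton) (hne : ∀ i, (F' i).Nonempty)
    (hfree : ∀ i ∉ B', F' i = F i) : Position π lab G r c t T s d F' B' where
  fixed := hfix
  nonempty := hne
  nonempty_mem i A hA := h.nonempty_mem i A (hF i hA)
  rich i hi := by rw [hfree i hi]; exact h.rich i fun h' => hi (hB h')
  uninformed S hS i hi := h.uninformed S (fun i => hF i (hS i)) i fun h' => hi (hB h')
  hist_eq S S' hS hS' v hv := by
    have hFS := fun i => hF i (hS i)
    have hFS' := fun i => hF i (hS' i)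
    -- Alignment now also admits the `t i` of newly fixed groups, which the old invariant on
    -- histories does not cover; they have received nothing so far.
    by_cases hvt : ∃ i, i ∉ B ∧ v = t i
    · obtain ⟨i, hi, rfl⟩ := hvt
      rw [h.uninformed S hFS i hi, h.uninformed S' hFS' i hi]
    · push Not at hvt
      exact h.hist_eq S S' hFS hFS' v ⟨hvt, hv.2⟩
  not_reached S hS i hi := h.not_reached S (fun i => hF i (hS i)) i fun h' => hi (hB h')

/-- After fixing at most two more groups, either two vertices of the clique transmit for
certain, or the groups that are not fixed are silent for certain. -/
theorem Position.fix_noisy (h : Position π lab G r c t T s d F B) (hs : GadgetSite G r c t) :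
    ∃ F' B', Position π lab G r c t T s d F' B' ∧ (∀ i, F' i ⊆ F i) ∧ B ⊆ B' ∧
      B'.card ≤ B.card + 2 ∧
      ((∃ x ∈ hub r c, ∃ y ∈ hub r c, x ≠ y ∧ ∀ S : ι → Set κ, (∀ i, S i ∈ F' i) →
          Transmits π lab (gadget G r c t S) s x ∧ Transmits π lab (gadget G r c t S) s y) ∨
        ∀ S : ι → Set κ, (∀ i, S i ∈ F' i) → ∀ i ∉ B', ∀ k,
          ¬ Transmits π lab (gadget G r c t S) s (c i k)) := by
  classical
  let Noisy : ι → Prop := fun i => i ∉ B ∧ ∃ S : ι → Set κ, (∀ j, S j ∈ F j) ∧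
    ∃ k, Transmits π lab (gadget G r c t S) s (c i k)
  choose A0 hA0 using h.nonempty
  have hw : ∀ i, ∃ S : ι → Set κ, (∀ j, S j ∈ F j) ∧ (Noisy i →
      ∃ k, Transmits π lab (gadget G r c t S) s (c i k)) := fun i => by
    by_cases hi : Noisy i
    · obtain ⟨-, S, hS, hk⟩ := hi
      exact ⟨S, hS, fun _ => hk⟩
    · exact ⟨A0, hA0, fun h' => (hi h').elim⟩
  -- Fixing group `i` at `W i i` alone keeps its transmission: it does not depend on the sets of the
  -- other groups.
  choose W hW hWk using hw
  have main : ∀ E : Finset ι, E.card ≤ 2 →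
      Position π lab G r c t T s d (fun i => if i ∈ E ∧ i ∉ B then {W i i} else F i) (B ∪ E) ∧
      (∀ i, (if i ∈ E ∧ i ∉ B then {W i i} else F i) ⊆ F i) ∧
      (B ∪ E).card ≤ B.card + 2 := by
    intro E hE
    have hsub : ∀ i, (if i ∈ E ∧ i ∉ B then {W i i} else F i) ⊆ F i := fun i => by
      split_ifs
      · exact Set.singleton_subset_iff.2 (hW i i)
      · exact subset_rfl
    refine ⟨h.fix hsub Finset.subset_union_left (fun i hi => ?_) (fun i => ?_) fun i hi => ?_,
      hsub, (Finset.card_union_le _ _).trans (by omega)⟩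
    · rw [Finset.mem_union] at hi
      split_ifs with hc
      · exact Set.subsingleton_singleton
      · exact h.fixed i (by tauto)
    · split_ifs
      · exact Set.singleton_nonempty _
      · exact h.nonempty i
    · rw [Finset.mem_union] at hi
      rw [if_neg (by tauto)]
  by_cases h2 : ∃ i j, i ≠ j ∧ Noisy i ∧ Noisy j
  · obtain ⟨i, j, hij, hi, hj⟩ := h2
    obtain ⟨hP, hsub, hcard⟩ := main {i, j} Finset.card_le_two
    refine ⟨_, _, hP, hsub, Finset.subset_union_left, hcard, Or.inl ?_⟩
    obtain ⟨k, hk⟩ := hWk i hi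
    obtain ⟨l, hl⟩ := hWk j hj
    refine ⟨c i k, c_mem_hub i k, c j l, c_mem_hub j l,
      fun h' => hij (hs.c_inj _ _ _ _ h').1, fun S hS => ?_⟩
    have hSF := fun i => hsub i (hS i)
    have hi' : S i = W i i := by simpa [hi.1] using hS i
    have hj' : S j = W j j := by simpa [hj.1] using hS j
    exact ⟨(h.transmits_c hs (hW i) hSF (by rw [hi'])).1 hk,
      (h.transmits_c hs (hW j) hSF (by rw [hj'])).1 hl⟩
  · have hE : ∃ E : Finset ι, E.card ≤ 2 ∧ ∀ i, Noisy i → i ∈ E := by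
      by_cases h1 : ∃ i, Noisy i
      · obtain ⟨i, hi⟩ := h1
        refine ⟨{i}, by simp, fun j hj => ?_⟩
        by_contra hne
        exact h2 ⟨j, i, by simpa using hne, hj, hi⟩
      · exact ⟨∅, by simp, fun i hi => (h1 ⟨i, hi⟩).elim⟩
    obtain ⟨E, hE2, hE⟩ := hE
    obtain ⟨hP, hsub, hcard⟩ := main E hE2
    refine ⟨_, _, hP, hsub, Finset.subset_union_left, hcard, Or.inr fun S hS i hi k hk => ?_⟩
    rw [Finset.mem_union, not_or] at hi
    exact hi.2 (hE i ⟨hi.1, S, fun i => hsub i (hS i), k, hk⟩)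

/-- The adversary survives one more round at the price of two groups. -/
theorem Position.succ (h : Position π lab G r c t T s (d + 1) F B) (hs : GadgetSite G r c t)
    (hl : ∀ i, lab (t i) ≠ 0) :
    ∃ F' B', Position π lab G r c t T (s + 1) d F' B' ∧ B'.card ≤ B.card + 2 := by
  obtain ⟨F₁, h₁, hreach⟩ := h.thin hs
  obtain ⟨F', B', h', hF, hB, hcard, hdich⟩ := h₁.fix_noisy hs
  have hreach' : ∀ S : ι → Set κ, (∀ i, S i ∈ F' i) → ∀ i ∉ B',
      ¬ Reached π lab (gadget G r c t S) s (t i) := fun S hS i hi =>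
    hreach S (fun i => hF i (hS i)) i fun hb => hi (hB hb)
  refine ⟨F', B', ⟨h'.fixed, h'.nonempty, h'.nonempty_mem, h'.rich, fun S hS i hi =>
    hist_succ_of_not_reached (h'.uninformed S hS i hi) (hreach' S hS i hi),
    fun S S' hS hS' v hv => ?_, fun S hS i hi s' h1 h2 => ?_⟩, hcard⟩
  · have hadj := fun w => hv.adj_iff (G := G) (r := r)
      (fun i hi => h'.fixed i hi (hS i) (hS' i)) w
    rw [hist_succ, hist_succ, h'.hist_eq S S' hS hS' v hv]
    congr 2
    have hsilent : ∀ S : ι → Set κ, (∀ i, S i ∈ F' i) → ∀ i ∉ B',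
        ¬ Transmits π lab (gadget G r c t S) s (t i) := fun S hS i hi =>
      not_transmits_of_uninformed (hl i) (h'.uninformed S hS i hi)
    -- A vertex that may behave differently for `S` and `S'` lies in an undecided group: either a
    -- silent `t i` or some `c i k`. Only the latter can leak information.
    have hcases : ∀ w, Aligned c t B' S S' w ∨ (∃ i, i ∉ B' ∧ w = t i) ∨
        ∃ i, i ∉ B' ∧ ∃ k, w = c i k := fun w => by
      by_contra! hcon
      obtain ⟨h1, h2, h3⟩ := hcon
      refine h1 ⟨h2, fun i k hw => ?_⟩
      have hi : i ∈ B' := by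
        by_contra hi
        exact h3 i hi k hw
      rw [h'.fixed i hi (hS i) (hS' i)]
    rcases hdich with ⟨x, hx, y, hy, hxy, hT⟩ | hq
    · by_cases hvQ : v ∈ hub r c
      -- In the collision case a clique vertex either transmits itself or has both transmitters as
      -- neighbours, so it hears nothing.
      · have hnone : ∀ S : ι → Set κ, (∀ i, S i ∈ F' i) →
            hear lab (gadget G r c t S) (action π lab (gadget G r c t S) s) v = none := by
          intro S hS
          by_cases hvx : v = x
          · exact hear_of_transmits (hvx ▸ (hT S hS).1)
          by_cases hvy : v = y
          · exact hear_of_transmits (hvy ▸ (hT S hS).2)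
          refine hear_of_not_reached fun hR => hxy ?_
          exact hR.unique ⟨adj_hub hvQ hx hvx, (hT S hS).1⟩ ⟨adj_hub hvQ hy hvy, (hT S hS).2⟩
        rw [hnone S hS, hnone S' hS']
      · refine hear_congr (h'.action_eq hS hS' hv) hadj fun w hw => ?_
        rcases hcases w with ha | ⟨i, hi, rfl⟩ | ⟨i, hi, k, rfl⟩
        · exact Or.inl (h'.action_eq hS hS' ha)
        · exact Or.inr ⟨hsilent S hS i hi, hsilent S' hS' i hi⟩
        -- Outside the clique, only `t i` itself could be adjacent to `c i k`, and alignment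
        -- excludes it since group `i` is undecided.
        · exfalso
          rcases hw with hw | ⟨-, hw | hw | hw⟩
          · exact hs.c_isolated i k v hw.symm
          · exact hvQ hw.1
          · obtain ⟨j, l, -, hvt, hc⟩ := hw
            obtain ⟨rfl, -⟩ := hs.c_inj _ _ _ _ hc
            exact hv.1 i hi hvt
          · obtain ⟨j, l, -, hct, -⟩ := hw
            exact hs.c_ne_t i k j hct
    · refine hear_congr (h'.action_eq hS hS' hv) hadj fun w _ => ?_
      rcases hcases w with ha | ⟨i, hi, rfl⟩ | ⟨i, hi, k, rfl⟩
      · exact Or.inl (h'.action_eq hS hS' ha)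
      · exact Or.inr ⟨hsilent S hS i hi, hsilent S' hS' i hi⟩
      · exact Or.inr ⟨hq S hS i hi k, hq S' hS' i hi k⟩
  · rcases Nat.lt_succ_iff_lt_or_eq.1 h2 with h3 | rfl
    · exact h'.not_reached S hS i hi s' h1 h3
    · exact hreach' S hS i hi

theorem agreeOff_gadget {U : Set V} (hr : r ∈ U) (hc : ∀ i k, c i k ∈ U) (ht : ∀ i, t i ∈ U)
    (S : ι → Set κ) : AgreeOff U G (gadget G r c t S) := by
  have hub_sub : hub r c ⊆ U := by
    rintro v (rfl | ⟨i, k, rfl⟩)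
    exacts [hr, hc i k]
  intro u w huw
  refine ⟨Or.inl, ?_⟩
  rintro (h | ⟨-, h | ⟨i, k, -, rfl, rfl⟩ | ⟨i, k, -, rfl, rfl⟩⟩)
  · exact h
  · exact (huw ⟨hub_sub h.1, hub_sub h.2⟩).elim
  · exact (huw ⟨ht i, hc i k⟩).elim
  · exact (huw ⟨hc i k, ht i⟩).elim

/-- A gadget with more than `2 * τ` groups of more than `τ` vertices keeps some `t i` unreached
for `τ` rounds. -/
theorem exists_gadget [Fintype ι] [Fintype κ] {τ : ℕ} {U : Set V} (hs : GadgetSite G r c t)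
    (hι : 2 * τ < Fintype.card ι) (hκ : τ < Fintype.card κ) (hl : ∀ v ∈ U, lab v ≠ 0)
    (hr : r ∈ U) (hc : ∀ i k, c i k ∈ U) (ht : ∀ i, t i ∈ U) (hU : Stable π lab G U T) :
    ∃ (S : ι → Set κ) (i : ι), (∀ j, (S j).Nonempty) ∧ ∀ U' ⊆ U,
      (∀ v ∈ U', v = t i ∨ ∀ w, ¬ (gadget G r c t S).Adj v w) →
        Stable π lab (gadget G r c t S) U' (T + τ) := by
  have hagree := fun S => agreeOff_gadget (G := G) hr hc ht S
  have key : ∀ j ≤ τ, ∃ F B, Position π lab G r c t T (T + j) (τ - j) F B ∧ B.card ≤ 2 * j := by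
    intro j
    induction j with
    | zero =>
      refine fun _ => ⟨fun _ => {A | A.Nonempty}, ∅, ⟨by simp, fun i => (rich_nonempty hκ).nonempty,
        fun i A hA => hA, fun i _ => rich_nonempty hκ, fun S _ i _ => ?_, fun S S' _ _ v _ => ?_,
        fun S _ i _ s' h1 h2 => by omega⟩, by simp⟩
      · exact (hU.2 _ (hagree S) _).trans (hU.1 _ (ht i))
      · exact (hU.2 _ (hagree S) v).trans (hU.2 _ (hagree S') v).symm
    | succ j ih =>
      intro hj
      obtain ⟨F, B, hP, hB⟩ := ih (by omega)
      rw [show τ - j = τ - (j + 1) + 1 by omega] at hP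
      obtain ⟨F', B', hP', hB'⟩ := hP.succ hs fun i => hl _ (ht i)
      exact ⟨F', B', hP', by omega⟩
  obtain ⟨F, B, hP, hB⟩ := key τ le_rfl
  choose S hS using hP.nonempty
  -- At most `2 * τ` groups are fixed after `τ` rounds, so one group is left over.
  obtain ⟨i, hi⟩ : ∃ i, i ∉ B := by
    by_contra! hall
    have := Finset.card_le_card (fun i _ => hall i : Finset.univ ⊆ B)
    rw [Finset.card_univ] at this
    omega
  refine ⟨S, i, fun j => hP.nonempty_mem j _ (hS j), fun U' hU' hv => ?_⟩
  refine (hU.mono hU' (hagree S)).add (fun v hv => hl v (hU' hv)) τ fun s' h1 h2 v hvU => ?_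
  rcases hv v hvU with rfl | hiso
  · exact hP.not_reached S hS i hi s' h1 h2
  · rintro ⟨w, hw, -⟩
    exact hiso w hw.1

end Gadget

/-! ### Distances and diameter -/

section Near

variable {V : Type*} {G G' : SimpleGraph V} {u v w : V} {d e : ℕ}

/-- `u` and `v` are at distance at most `d`. -/
def Near (G : SimpleGraph V) (d : ℕ) (u v : V) : Prop :=
  ∃ p : G.Walk u v, p.length ≤ d

theorem Near.refl : Near G d u u := ⟨.nil, Nat.zero_le _⟩

theorem Near.symm (h : Near G d u v) : Near G d v u := by
  obtain ⟨p, hp⟩ := h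
  exact ⟨p.reverse, by simpa using hp⟩

theorem Near.trans (h : Near G d u v) (h' : Near G e v w) : Near G (d + e) u w := by
  obtain ⟨p, hp⟩ := h
  obtain ⟨q, hq⟩ := h'
  exact ⟨p.append q, by rw [SimpleGraph.Walk.length_append]; omega⟩

theorem Near.mono (h : Near G d u v) (hG : G ≤ G') (hd : d ≤ e) : Near G' e u v := by
  obtain ⟨p, hp⟩ := h
  exact ⟨p.mapLe hG, by simpa using hp.trans hd⟩

theorem near_of_adj (h : G.Adj u v) (hd : 1 ≤ d) : Near G d u v := ⟨.cons h .nil, by simpa⟩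

theorem level_le_of_walk {f : V → ℕ} (hf : ∀ u w, G.Adj u w → f u ≤ f w + 1) (p : G.Walk u v) :
    f u ≤ f v + p.length := by
  induction p with
  | nil => simp
  | cons h p ih =>
    have := hf _ _ h
    rw [SimpleGraph.Walk.length_cons]
    omega

theorem connected_of_near (s : V) (h : ∀ u v, Near G d u v) : G.Connected :=
  have : Nonempty V := ⟨s⟩
  ⟨fun u v => (h u v).elim fun p _ => ⟨p⟩⟩

/-- A level changes by at most 1 along an edge, so `s` and `r` are at least `d` apart. -/
theorem diam_eq_of_near_of_level [Finite V] {f : V → ℕ} {s r : V} (h : ∀ u v, Near G d u v)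
    (hf : ∀ u w, G.Adj u w → f u ≤ f w + 1) (hs : f s = 0) (hr : f r = d) : G.diam = d := by
  have : Nonempty V := ⟨s⟩
  have hc := connected_of_near s h
  have hub : G.diam ≤ d := by
    obtain ⟨u, v, huv⟩ := SimpleGraph.exists_dist_eq_diam (G := G)
    obtain ⟨p, hp⟩ := h u v
    rw [← huv]
    exact (SimpleGraph.dist_le p).trans hp
  refine hub.antisymm ?_
  obtain ⟨p, hp⟩ := hc.exists_walk_length_eq_dist r s
  have h1 := level_le_of_walk hf p
  have h2 : G.dist r s ≤ G.diam :=
    SimpleGraph.dist_le_diam (SimpleGraph.connected_iff_ediam_ne_top.1 hc)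
  omega

end Near

/-! ### The chain of gadgets -/

section Chain

/-- `a` core vertices and `g` gadgets with `K` groups of `q + 1` vertices. -/
abbrev ChainVertex (a g K q : ℕ) : Type := Fin a ⊕ Fin g × Fin K × Option (Fin q)

variable {a g K q m : ℕ} {Msg : Type*} {π : BroadcastProtocol m Msg}
  {lab : ChainVertex a g K q → Fin (m + 1)} {G : SimpleGraph (ChainVertex a g K q)}
  {src r : ChainVertex a g K q} {d j T : ℕ}

/-- The vertices of the gadgets that are not yet attached. -/
def unattached (j : ℕ) : Set (ChainVertex a g K q) := {v | ∃ x, v = Sum.inr x ∧ j ≤ x.1.val}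

variable (π lab G src r d j T) in
/-- After `j` gadgets have been attached, the last root `r` is at distance `d` from the source
and is not reached before round `T`. -/
structure Chain : Prop where
  isolated : ∀ v ∈ unattached j, ∀ w, ¬ G.Adj v w
  root : r ∉ unattached j
  label_root : lab r ≠ 0
  stable : Stable π lab G (insert r (unattached j)) T
  near_root : ∀ v ∉ unattached j, Near G d v r
  -- The 2 matters only at the start: two leaves of the star are at distance 2 even when the first
  -- root is its centre and `d = 1`.
  near : ∀ u ∉ unattached j, ∀ v ∉ unattached j, Near G (max d 2) u v
  level : ∃ f : ChainVertex a g K q → ℕ,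
    (∀ u w, G.Adj u w → f u ≤ f w + 1) ∧ f src = 0 ∧ f r = d

/-- The gadget is attached at `r`, and its unreached `t i₀` becomes the new root. Old vertices are
within `d` of `r`, new ones within 1 of the clique, and crossing the clique costs 1; this gives the
bound `d + 2`. -/
theorem Chain.succ {τ : ℕ} (h : Chain π lab G src r d j T) (hj : j < g) (hd : 1 ≤ d)
    (hK : 2 * τ < K) (hq : τ < q) (hsrc : src ∉ unattached j)
    (hl : ∀ v ∈ unattached j, lab v ≠ 0) :
    ∃ G' r', Chain π lab G' src r' (d + 2) (j + 1) (T + τ) := by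
  let c : Fin K → Fin q → ChainVertex a g K q := fun i k => Sum.inr (⟨j, hj⟩, i, some k)
  let t : Fin K → ChainVertex a g K q := fun i => Sum.inr (⟨j, hj⟩, i, none)
  have hcU : ∀ i k, c i k ∈ unattached j := fun i k => ⟨_, rfl, le_rfl⟩
  have htU : ∀ i, t i ∈ unattached j := fun i => ⟨_, rfl, le_rfl⟩
  have hs : GadgetSite G r c t :=
    { c_inj := fun i k i' k' he => by simpa [c] using he
      t_inj := fun i i' he => by simpa [t] using he
      c_ne_t := fun i k j => by simp [c, t]
      c_ne_r := fun i k he => h.root (he ▸ hcU i k)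
      t_ne_r := fun i he => h.root (he ▸ htU i)
      c_isolated := fun i k => h.isolated _ (hcU i k)
      t_isolated := fun i => h.isolated _ (htU i) }
  have hnew : ∀ v, v ∉ unattached (j + 1) →
      v ∉ unattached j ∨ (∃ i k, v = c i k) ∨ ∃ i, v = t i := by
    rintro v hv
    by_cases hvj : v ∈ unattached j
    · obtain ⟨⟨j', i, o⟩, rfl, hx⟩ := hvj
      have hj' : j' = ⟨j, hj⟩ := by
        by_contra hne
        refine hv ⟨_, rfl, ?_⟩
        have : j'.val ≠ j := fun h' => hne (Fin.ext h')
        dsimp only at hx ⊢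
        omega
      subst hj'
      cases o with
      | none => exact Or.inr (Or.inr ⟨i, rfl⟩)
      | some k => exact Or.inr (Or.inl ⟨i, k, rfl⟩)
    · exact Or.inl hvj
  have hUsub : (unattached (j + 1) : Set (ChainVertex a g K q)) ⊆ unattached j := by
    rintro _ ⟨x, rfl, hx⟩
    exact ⟨x, rfl, by omega⟩
  have htU' : ∀ i, t i ∉ unattached (j + 1) := by
    rintro i ⟨x, hx, hjx⟩
    obtain rfl := Sum.inr.inj hx
    simp at hjx
  have hcU' : ∀ i k, c i k ∉ unattached (j + 1) := by
    rintro i k ⟨x, hx, hjx⟩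
    obtain rfl := Sum.inr.inj hx
    simp at hjx
  obtain ⟨S, i₀, hS, hstable⟩ := exists_gadget (τ := τ) hs (by simpa using hK) (by simpa using hq)
    (Set.forall_mem_insert.2 ⟨h.label_root, hl⟩) (Set.mem_insert _ _)
    (fun i k => Set.mem_insert_of_mem _ (hcU i k)) (fun i => Set.mem_insert_of_mem _ (htU i))
    h.stable
  let G' := gadget G r c t S
  have hle : G ≤ G' := fun u w huw => Or.inl huw
  have hisolated : ∀ v ∈ unattached (j + 1), ∀ w, ¬ G'.Adj v w := by
    rintro v hv w (hw | ⟨-, ⟨hw, -⟩ | ⟨i, k, -, rfl, -⟩ | ⟨i, k, -, -, rfl⟩⟩)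
    · exact h.isolated v (hUsub hv) w hw
    · rcases hw with rfl | ⟨i, k, rfl⟩
      · exact h.root (hUsub hv)
      · exact hcU' i k hv
    · exact htU' i hv
    · exact hcU' i k hv
  have hub_near : ∀ u ∈ hub r c, ∀ w ∈ hub r c, Near G' 1 u w := fun u hu w hw => by
    by_cases huw : u = w
    · exact huw ▸ Near.refl
    · exact near_of_adj (adj_hub hu hw huw) le_rfl
  have ht_near : ∀ i, ∃ w ∈ hub r c, Near G' 1 (t i) w := fun i => by
    obtain ⟨k, hk⟩ := hS i
    exact ⟨c i k, c_mem_hub i k, near_of_adj ((hs.adj_t S i _).2 ⟨k, hk, rfl⟩) le_rfl⟩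
  have hnew_near : ∀ v, ((∃ i k, v = c i k) ∨ ∃ i, v = t i) → ∃ w ∈ hub r c, Near G' 1 v w := by
    rintro v (⟨i, k, rfl⟩ | ⟨i, rfl⟩)
    · exact ⟨c i k, c_mem_hub i k, Near.refl⟩
    · exact ht_near i
  have hall_near : ∀ v ∉ unattached (j + 1), ∃ w ∈ hub r c, Near G' d v w := fun v hv => by
    rcases hnew v hv with hv | hv
    · exact ⟨r, Or.inl rfl, (h.near_root v hv).mono hle le_rfl⟩
    · obtain ⟨w, hw, hvw⟩ := hnew_near v hv
      exact ⟨w, hw, hvw.mono le_rfl hd⟩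
  have hnear : ∀ u ∉ unattached (j + 1), ∀ v, ((∃ i k, v = c i k) ∨ ∃ i, v = t i) →
      Near G' (d + 2) u v := fun u hu v hv => by
    obtain ⟨w, hw, huw⟩ := hall_near u hu
    obtain ⟨x, hx, hvx⟩ := hnew_near v hv
    exact ((huw.trans (hub_near w hw x hx)).trans hvx.symm).mono le_rfl (by omega)
  refine ⟨G', t i₀, hisolated, htU' i₀, hl _ (htU i₀), hstable _ ?_ ?_,
    fun v hv => hnear v hv _ (Or.inr ⟨i₀, rfl⟩), fun u hu v hv => ?_, ?_⟩
  · exact Set.insert_subset (Set.mem_insert_of_mem _ (htU i₀))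
      (hUsub.trans (Set.subset_insert _ _))
  · rintro v (rfl | hv)
    · exact Or.inl rfl
    · exact Or.inr (hisolated v hv)
  · rcases hnew v hv with hv' | hv'
    · rcases hnew u hu with hu' | hu'
      · exact (h.near u hu' v hv').mono hle (by omega)
      · exact (hnear v hv u hu').symm.mono le_rfl (le_max_left _ _)
    · exact (hnear u hu v hv').mono le_rfl (le_max_left _ _)
  · classical
    obtain ⟨f, hf, hf0, hfr⟩ := h.level
    -- Only the `c i k` and `t i` of the new gadget matter here; the vertices of later gadgets also
    -- get level `d + 1`, harmlessly, as they are isolated.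
    let f' : ChainVertex a g K q → ℕ := fun v =>
      if v ∈ unattached j then (if ∃ i, v = t i then d + 2 else d + 1) else f v
    have hft : ∀ i, f' (t i) = d + 2 := fun i => by
      simp only [f', if_pos (htU i)]
      rw [if_pos ⟨i, rfl⟩]
    have hfc : ∀ i k, f' (c i k) = d + 1 := fun i k => by
      simp only [f', if_pos (hcU i k)]
      rw [if_neg]
      rintro ⟨i', h'⟩
      exact hs.c_ne_t _ _ _ h'
    have hfo : ∀ v, v ∉ unattached j → f' v = f v := fun v hv => if_neg hv
    have hfh : ∀ v ∈ hub r c, d ≤ f' v ∧ f' v ≤ d + 1 := by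
      rintro v (rfl | ⟨i, k, rfl⟩)
      · rw [hfo _ h.root, hfr]
        omega
      · rw [hfc]
        omega
    refine ⟨f', ?_, by rw [hfo _ hsrc, hf0], hft i₀⟩
    rintro u w (huw | ⟨-, ⟨hu, hw⟩ | ⟨i, k, -, rfl, rfl⟩ | ⟨i, k, -, rfl, rfl⟩⟩)
    · rw [hfo u fun h' => h.isolated u h' w huw, hfo w fun h' => h.isolated w h' u huw.symm]
      exact hf u w huw
    · have := hfh u hu
      have := hfh w hw
      omega
    · rw [hft, hfc]
    · rw [hft, hfc]
      omega

/-- The star on the core vertices, centred at `z`. -/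
def coreStar (z : Fin a) : SimpleGraph (ChainVertex a g K q) where
  Adj u w := u ≠ w ∧ (∃ x y, u = Sum.inl x ∧ w = Sum.inl y) ∧ (u = Sum.inl z ∨ w = Sum.inl z)
  symm := ⟨fun _ _ h => ⟨h.1.symm, by obtain ⟨-, ⟨x, y, h1, h2⟩, -⟩ := h; exact ⟨y, x, h2, h1⟩,
    h.2.2.symm⟩⟩
  loopless := ⟨fun _ h => h.1 rfl⟩

/-- The source is a leaf of the star, and the first root is the centre or another leaf. -/
theorem exists_chain_zero {p : ℕ} (hp : p = 1 ∨ p = 2) (hpa : p < a)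
    (hl : ∀ v, v ≠ Sum.inl ⟨0, by omega⟩ → lab v ≠ 0) :
    ∃ G r, Chain π lab G (Sum.inl ⟨0, by omega⟩) r p 0 0 := by
  have hinl : ∀ x : Fin a, (Sum.inl x : ChainVertex a g K q) ∉ unattached 0 := by
    rintro x ⟨y, hy, -⟩
    cases hy
  have hold : ∀ v : ChainVertex a g K q, v ∉ unattached 0 → ∃ x, v = Sum.inl x := by
    rintro (x | x) hx
    · exact ⟨x, rfl⟩
    · exact (hx ⟨x, rfl, Nat.zero_le _⟩).elim
  let z : Fin a := ⟨1, by omega⟩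
  have hz : ∀ x, Near (coreStar z : SimpleGraph (ChainVertex a g K q)) 1 (Sum.inl x)
      (Sum.inl z) := fun x => by
    by_cases hx : x = z
    · exact hx ▸ Near.refl
    · exact near_of_adj ⟨by simpa using hx, ⟨_, _, rfl, rfl⟩, Or.inr rfl⟩ le_rfl
  refine ⟨coreStar z, Sum.inl ⟨p, hpa⟩, ?_, hinl _, hl _ (by simp; omega), stable_zero _ _,
    fun v hv => ?_, fun u hu v hv => ?_, ?_⟩
  · rintro v hv w ⟨-, ⟨x, y, rfl, -⟩, -⟩
    exact hinl x hv
  · obtain ⟨x, rfl⟩ := hold v hv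
    rcases hp with rfl | rfl
    · exact hz x
    · exact (hz x).trans (hz _).symm
  · obtain ⟨x, rfl⟩ := hold u hu
    obtain ⟨y, rfl⟩ := hold v hv
    exact ((hz x).trans (hz y).symm).mono le_rfl (le_max_right _ _)
  -- The source 0 has level 0, the centre 1 has level 1, and all other leaves have level 2.
  · refine ⟨Sum.elim (fun x => min x.val 2) fun _ => 0, ?_, by simp, by simp; omega⟩
    rintro u w ⟨-, ⟨x, y, rfl, rfl⟩, h | h⟩ <;> obtain rfl := Sum.inl.inj h <;> simp [z]

theorem exists_chain {p τ : ℕ} (hp : p = 1 ∨ p = 2) (hpa : p < a) (hK : 2 * τ < K) (hq : τ < q)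
    (hl : ∀ v, v ≠ Sum.inl ⟨0, by omega⟩ → lab v ≠ 0) (hj : j ≤ g) :
    ∃ G r, Chain π lab G (Sum.inl ⟨0, by omega⟩) r (p + 2 * j) j (j * τ) := by
  induction j with
  | zero => simpa using exists_chain_zero hp hpa hl
  | succ j ih =>
    obtain ⟨G, r, h⟩ := ih (by omega)
    have hsrc : (Sum.inl ⟨0, by omega⟩ : ChainVertex a g K q) ∉ unattached j := by
      rintro ⟨y, hy, -⟩
      cases hy
    obtain ⟨G', r', h'⟩ := h.succ (by omega) (by omega) hK hq hsrc
      fun v hv => hl v fun h' => hsrc (h' ▸ hv)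
    refine ⟨G', r', ?_⟩
    rwa [Nat.mul_succ 2 j, Nat.succ_mul j τ]

theorem exists_labelling {V : Type} [Fintype V] (h : Fintype.card V ≤ m + 1) (s : V) :
    ∃ lab : V → Fin (m + 1), Function.Injective lab ∧ lab s = 0 := by
  obtain ⟨f⟩ : Nonempty (V ↪ Fin (m + 1)) :=
    Function.Embedding.nonempty_of_card_le (by simpa using h)
  exact ⟨fun v => Equiv.swap (f s) 0 (f v), (Equiv.injective _).comp f.injective, by simp⟩

/-- Vertices not needed for gadgets are added to the star, which gives exactly `n` nodes without
changing the diameter. Both time bounds come from the last root: its level is the diameter, and it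
has received nothing before round `g * τ`. -/
theorem exists_slow_network {n p τ : ℕ} (π : BroadcastProtocol m Msg) (hp : p = 1 ∨ p = 2)
    (hg : 1 ≤ g) (hn : p + g * ((2 * τ + 1) * (τ + 2)) < n) (hm : n ≤ m + 1) :
    ∃ (V : Type) (_ : Fintype V) (N : RadioNetwork V m), Fintype.card V = n ∧
      N.graph.diam = p + 2 * g ∧ ∀ r, π.CompletesIn N r → p + 2 * g ≤ r ∧ g * τ < r := by
  obtain ⟨a, rfl⟩ : ∃ a, n = a + g * ((2 * τ + 1) * (τ + 2)) := 
    ⟨n - g * ((2 * τ + 1) * (τ + 2)), by omega⟩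
  have hcard : Fintype.card (ChainVertex a g (2 * τ + 1) (τ + 1)) =
      a + g * ((2 * τ + 1) * (τ + 2)) := by simp
  obtain ⟨lab, hinj, h0⟩ := exists_labelling (hcard.trans_le hm) (Sum.inl ⟨0, by omega⟩)
  have hl : ∀ v, v ≠ Sum.inl ⟨0, by omega⟩ → lab v ≠ 0 := fun v hv hv0 =>
    hv (hinj (hv0.trans h0.symm))
  obtain ⟨G, z, hG⟩ := exists_chain (π := π) hp (by omega : p < a) (by omega : 2 * τ < 2 * τ + 1)
    (by omega : τ < τ + 1) hl le_rfl
  have hall : ∀ v : ChainVertex a g (2 * τ + 1) (τ + 1), v ∉ unattached g := by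
    rintro v ⟨x, -, hx⟩
    have := x.1.isLt
    omega
  have hnear : ∀ u v, Near G (p + 2 * g) u v := fun u v =>
    (hG.near u (hall u) v (hall v)).mono le_rfl (by omega)
  obtain ⟨f, hf, hf0, hfz⟩ := hG.level
  refine ⟨_, inferInstance, ⟨G, connected_of_near z hnear, lab, hinj, _, h0⟩, hcard,
    diam_eq_of_near_of_level hnear hf hf0 hfz, fun r hr => ?_⟩
  obtain ⟨x, hx, hx'⟩ := hr z fun h => hG.label_root (h ▸ h0)
  rw [history_eq_hist] at hx
  constructor
  · by_contra! hlt
    rw [hist_of_lt_level hf (fun u hu => by rw [← hf0]; congr 1; by_contra h; exact hl u h hu)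
      (hfz ▸ hlt)] at hx
    exact hx' (List.mem_replicate.1 hx).2
  · by_contra! hle
    have hx := hist_subset hle hx
    rw [hG.stable.1 z (Set.mem_insert _ _)] at hx
    exact hx' (List.mem_replicate.1 hx).2

end Chain

/-- The arithmetic behind the choice of `τ` as about `√(n / g)`. -/
theorem sqrt_le_of_bounds {n D g τ r : ℕ} (hD : D ≤ 4 * g) (hgD : g ≤ D) (hDn : D < n) (hD3 : 3 ≤ D)
    (hτ : n - 3 < (τ + 1) * (τ + 1) * (9 * g)) (hDr : D ≤ r) (hr : g * τ < r) :
    1 / 30 * Real.sqrt ((n : ℝ) * (D : ℝ)) ≤ (r : ℝ) := by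
  have h4 : n ≤ 4 * ((τ + 1) * (τ + 1) * (9 * g)) := by omega
  have key : n * D ≤ (30 * r) ^ 2 := by
    -- For `τ = 0` the delay bound is void, but then `n = O(g)` and the trivial bound `D ≤ r`
    -- suffices.
    rcases Nat.eq_zero_or_pos τ with h0 | h0
    · subst h0
      have h1 : n ≤ 36 * r := by omega
      calc n * D ≤ 36 * r * r := Nat.mul_le_mul h1 hDr
        _ ≤ (30 * r) ^ 2 := by nlinarith
    · have h1 : (τ + 1) * (τ + 1) ≤ (2 * τ) * (2 * τ) := Nat.mul_le_mul (by omega) (by omega)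
      calc n * D ≤ 4 * ((2 * τ) * (2 * τ) * (9 * g)) * (4 * g) :=
            Nat.mul_le_mul (h4.trans (Nat.mul_le_mul_left _ (Nat.mul_le_mul_right _ h1))) hD
        _ = (24 * (g * τ)) ^ 2 := by ring
        _ ≤ (30 * r) ^ 2 := Nat.pow_le_pow_left (by omega) 2
  have : Real.sqrt ((n : ℝ) * D) ≤ 30 * r := by
    refine Real.sqrt_le_iff.2 ⟨by positivity, ?_⟩
    exact_mod_cast key
  linarith

end RadioBroadcast

theorem mainTheorem2 :
    ∃ c : ℝ, 0 < c ∧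
      ∀ n D m : ℕ, 3 ≤ D → D < n → n ≤ m + 1 →
        ∀ (Msg : Type*) (π : BroadcastProtocol m Msg),
          ∃ (V : Type) (_ : Fintype V) (N : RadioNetwork V m),
            Fintype.card V = n ∧ N.graph.diam = D ∧
              ∀ r : ℕ, π.CompletesIn N r → c * Real.sqrt ((n : ℝ) * (D : ℝ)) ≤ (r : ℝ) := by
  refine ⟨1 / 30, by norm_num, fun n D m hD hDn hnm Msg π => ?_⟩
  -- Each gadget contributes 2, so the distance `p` inside the star takes care of the parity of `D`.
  obtain ⟨g, p, hp, hg, rfl⟩ : ∃ g p, (p = 1 ∨ p = 2) ∧ 1 ≤ g ∧ D = p + 2 * g :=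
    ⟨(D - 1) / 2, D - 2 * ((D - 1) / 2), by omega, by omega, by omega⟩
  -- The 9 comes from `(2τ + 1)(τ + 2) ≤ 9τ²` for `τ ≥ 1`; the 3 leaves room for the `p + 1 ≤ 3`
  -- star vertices that are needed.
  let τ := Nat.sqrt ((n - 3) / (9 * g))
  have hτ1 : τ * τ * (9 * g) ≤ n - 3 :=
    (Nat.mul_le_mul_right _ (Nat.sqrt_le _)).trans (Nat.div_mul_le_self _ _)
  have hτ2 : n - 3 < (τ + 1) * (τ + 1) * (9 * g) := by
    rw [← Nat.div_lt_iff_lt_mul (by omega)]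
    exact Nat.lt_succ_sqrt _
  have hn : p + g * ((2 * τ + 1) * (τ + 2)) < n := by
    rcases Nat.eq_zero_or_pos τ with h0 | h0
    · rw [h0]
      omega
    · have h1 : (2 * τ + 1) * (τ + 2) ≤ (3 * τ) * (3 * τ) :=
        Nat.mul_le_mul (by omega) (by omega)
      have h2 := Nat.mul_le_mul_left g h1
      have h3 : g * (3 * τ * (3 * τ)) = τ * τ * (9 * g) := by ring
      omega
  obtain ⟨V, hV, N, h1, h2, h3⟩ := RadioBroadcast.exists_slow_network π hp hg hn hnm
  refine ⟨V, hV, N, h1, h2, fun r hr => ?_⟩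
  exact RadioBroadcast.sqrt_le_of_bounds (by omega) (by omega) hDn hD hτ2 (h3 r hr).1 (h3 r hr).2
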